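/- Let $F_n$ be the free group of rank $n$, with lower central series $F_{n,0}=F_n$, $F_{n,k+1}=[F_{n,k},F_n]$. For a group $\Gamma$ let $d_2(\Gamma)\in\{0,1,2,\dots\}\cup\{\infty\}$ be the largest $n\ge 0$ for which there is an epimorphism $\Gamma\to F_n/F_{n,2}$. Call classes $v_1,\dots,v_n\in H^1(\Gamma,\mathbb Z)$ (trivial coefficients) primitive if the homomorphism $(v_1,\dots,v_n):H_1(\Gamma,\mathbb Z)\to\mathbb Z^n$ given by evaluation is surjective, and let $c_2(\Gamma)\in\{0,1,2,\dots\}\cup\{\infty\}$ be the largest $n\ge 0$ for which there are primitive classes $v_1,\dots,v_n\in H^1(\Gamma,\mathbb Z)$ with $v_i\cup v_j=0$ in $H^2(\Gamma,\mathbb Z)$ for all $i,j$. (Each number is $\infty$ if arbitrarily large $n$ occur.) Then, for every group $\Gamma$, $$d_2(\Gamma)=c_2(\Gamma).$$ -/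

import Mathlib

noncomputable section

open scoped TensorProduct

universe u

/-- The `k`-th term `F_{n,k}` of the lower central series of the free group `F_n`, indexed so that
`F_{n,0} = F_n` and `F_{n,k+1} = [F_{n,k}, F_n]`. -/
abbrev freeLCS (n k : ℕ) : Subgroup (FreeGroup (Fin n)) :=
  (⊤ : Subgroup (FreeGroup (Fin n))).lowerCentralSeries k

/-- There is an epimorphism from `Γ` onto `F_n / F_{n,k}`, the free nilpotent group of class `k`
on `n` generators. -/
def MapsOntoFreeNilpotent (Γ : Type u) [Group Γ] (k n : ℕ) : Prop :=
  ∃ f : Γ →* FreeGroup (Fin n) ⧸ freeLCS n k, Function.Surjective f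

/-- `d_k(Γ)`: the largest `n` such that `Γ` maps onto `F_n / F_{n,k}`, as an element of `ℕ∞`.
It is `⊤` when there are arbitrarily large such `n`; the value `n = 0` is always allowed. -/
def dNumber (k : ℕ) (Γ : Type u) [Group Γ] : ℕ∞ :=
  ⨆ (n : ℕ) (_ : MapsOntoFreeNilpotent Γ k n), (n : ℕ∞)

/-- The trivial `Γ`-module `ℤ`. The ring `ℤ` is lifted to the universe of `Γ`, as Mathlib's group
(co)homology asks for. -/
abbrev trivialZ (Γ : Type u) [Group Γ] : Rep.{u} (ULift.{u} ℤ) Γ :=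
  Rep.trivial (ULift.{u} ℤ) Γ (ULift.{u} ℤ)

/-- The integral homology group `H_1(Γ, ℤ)`. -/
abbrev HomologyOne (Γ : Type u) [Group Γ] : Type u := groupHomology.H1 (trivialZ Γ)

/-- The integral cohomology group `H^1(Γ, ℤ)`. -/
abbrev CohomologyOne (Γ : Type u) [Group Γ] : Type u := groupCohomology.H1 (trivialZ Γ)

/-- The integral cohomology group `H^2(Γ, ℤ)`. -/
abbrev CohomologyTwo (Γ : Type u) [Group Γ] : Type u := groupCohomology.H2 (trivialZ Γ)

variable {Γ : Type u} [Group Γ]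

/-- The homomorphism `Γ → ℤ` that a class in `H^1(Γ, ℤ)` is: as the action is trivial, this is the
unique `1`-cocycle in the class. -/
def CohomologyOne.toHom (v : CohomologyOne Γ) : Additive Γ →+ ULift.{u} ℤ :=
  (groupCohomology.H1IsoOfIsTrivial (trivialZ Γ)).hom v

theorem CohomologyOne.toHom_mk (f : groupCohomology.cocycles₁ (trivialZ Γ)) (g : Γ) :
    CohomologyOne.toHom (groupCohomology.H1π (trivialZ Γ) f) (Additive.ofMul g) = f g :=
  groupCohomology.H1IsoOfIsTrivial_H1π_apply_apply f (Additive.ofMul g)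

/-- The Kronecker pairing `H^1(Γ, ℤ) × H_1(Γ, ℤ) → ℤ`, `⟨v, [γ ⊗ a]⟩ = v(γ) a`, through Mathlib's
identification of `H_1(Γ, ℤ)` with `Γᵃᵇ ⊗ ℤ`. -/
def kronecker (v : CohomologyOne Γ) : HomologyOne Γ →+ ℤ :=
  (AddEquiv.ulift.toAddMonoidHom.comp
    (TensorProduct.lift
      ((LinearMap.mul ℤ (ULift.{u} ℤ)).comp
        (MonoidHom.toAdditiveLeft (Abelianization.lift
          (AddMonoidHom.toMultiplicativeRight v.toHom))).toIntLinearMap)).toAddMonoidHom).comp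
    (groupHomology.H1ToTensorOfIsTrivial (trivialZ Γ)).toAddMonoidHom

/-- On cycles, the Kronecker pairing evaluates the cocycle on the cycle. -/
theorem kronecker_mk (v : CohomologyOne Γ) (γ : Γ) (a : ULift.{u} ℤ) :
    kronecker v (groupHomology.H1π (trivialZ Γ)
      ((groupHomology.cycles₁IsoOfIsTrivial (trivialZ Γ)).inv (Finsupp.single γ a))) =
      (v.toHom (Additive.ofMul γ)).down * a.down := by
  have h := groupHomology.H1ToTensorOfIsTrivial_H1π_single (A := trivialZ Γ) γ a
  simp only [kronecker, AddMonoidHom.comp_apply, LinearMap.toAddMonoidHom_coe]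
  erw [h]
  rfl

/-- A family `v_1, …, v_n` in `H^1(Γ, ℤ)` is primitive if the map
`(v_1, …, v_n) : H_1(Γ, ℤ) → ℤⁿ` is onto. -/
def IsPrimitiveFamily {n : ℕ} (v : Fin n → CohomologyOne Γ) : Prop :=
  Function.Surjective fun (x : HomologyOne Γ) (i : Fin n) => kronecker (v i) x

/-- The cochain `(x, y) ↦ -f(x) g(y)` attached to two homomorphisms `f, g : Γ → ℤ` is a
`2`-cocycle. -/
def cupCocycle (f g : Additive Γ →+ ULift.{u} ℤ) : groupCohomology.cocycles₂ (trivialZ Γ) :=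
  ⟨fun p => -(f (Additive.ofMul p.1) * g (Additive.ofMul p.2)), by
    rw [groupCohomology.mem_cocycles₂_iff]
    intro a b c
    simp only [ofMul_mul, map_add, Representation.isTrivial_def, LinearMap.id_apply]
    ring⟩

/-- The cup product `H^1(Γ, ℤ) × H^1(Γ, ℤ) → H^2(Γ, ℤ)`, induced on inhomogeneous cochains by
`(f ∪ g)(x, y) = -f(x) g(y)` (the usual sign `(-1)^{pq}` for classes of degrees `p = q = 1`). -/
def cup (v w : CohomologyOne Γ) : CohomologyTwo Γ :=
  groupCohomology.H2π (trivialZ Γ) (cupCocycle v.toHom w.toHom)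

/-- `Γ` has a primitive family `v_1, …, v_n` in `H^1(Γ, ℤ)` with `v_i ∪ v_j = 0` for all `i, j`. -/
def HasPrimitiveCupZero (Γ : Type u) [Group Γ] (n : ℕ) : Prop :=
  ∃ v : Fin n → CohomologyOne Γ, IsPrimitiveFamily v ∧ ∀ i j, cup (v i) (v j) = 0

/-- `c_2(Γ)`, the algebraic cut number: the largest `n` for which there is a primitive set
`v_1, …, v_n` in `H^1(Γ, ℤ)` with all `v_i ∪ v_j = 0`, as an element of `ℕ∞` (the members of a
primitive family are pairwise distinct). It is `⊤` when there are arbitrarily large such `n`; the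
value `n = 0` is always allowed. -/
def cTwo (Γ : Type u) [Group Γ] : ℕ∞ :=
  ⨆ (n : ℕ) (_ : HasPrimitiveCupZero Γ n), (n : ℕ∞)

end

noncomputable section
open scoped TensorProduct
universe u
open scoped commutatorElement IsMulCommutative

/-! ### Cohomology classes of degree one as homomorphisms -/

/-! A homomorphism into a Heisenberg group is a family of homomorphisms `f i : Γ → ℤ` together with,
for each `p`, a function whose deviation from additivity is `f (s p)` times `f (t p)`, that is, a
trivialisation of that cup product. So cup products vanish exactly when the `f i` lift to a
Heisenberg group.

The Heisenberg group on the pairs `i < j` is the free nilpotent group of class two: commutators of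
generators give the basis of its centre's central coordinates, which yields both injectivity
(`injective_of_comp_eq_freeToHeisenberg`) and the fact that a homomorphism to it is onto once its
linear part is (`FreeHeisenberg.surjective_of_lin_surjective`). Primitivity is surjectivity of the
linear part, so the two conditions agree for each `n`. -/

/-- The class in `H¹(Γ, ℤ)` of a homomorphism. -/
def CohomologyOne.ofHom {Γ : Type u} [Group Γ] (f : Additive Γ →+ ULift.{u} ℤ) :
    CohomologyOne Γ :=
  (groupCohomology.H1IsoOfIsTrivial (trivialZ Γ)).inv f

theorem CohomologyOne.toHom_ofHom {Γ : Type u} [Group Γ] (f : Additive Γ →+ ULift.{u} ℤ) :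
    (CohomologyOne.ofHom f).toHom = f :=
  congrArg (fun φ => φ.hom f) (groupCohomology.H1IsoOfIsTrivial (trivialZ Γ)).inv_hom_id

/-- The values of a family of degree one classes on a homology class are its values on a single
group element. -/
theorem exists_kronecker_eq_toHom {Γ : Type u} [Group Γ] {n : ℕ} (v : Fin n → CohomologyOne Γ)
    (x : HomologyOne Γ) :
    ∃ g : Γ, ∀ i, kronecker (v i) x = ((v i).toHom (Additive.ofMul g)).down := by
  have key : ∀ y : Additive (Abelianization Γ) ⊗[ℤ] ULift.{u} ℤ, ∃ g : Γ, ∀ i,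
      (TensorProduct.lift
        ((LinearMap.mul ℤ (ULift.{u} ℤ)).comp
          (MonoidHom.toAdditiveLeft (Abelianization.lift
            (AddMonoidHom.toMultiplicativeRight (v i).toHom))).toIntLinearMap) y).down =
        ((v i).toHom (Additive.ofMul g)).down := by
    intro y
    induction y with
    | zero => exact ⟨1, fun i => by simp⟩
    | add y z hy hz =>
      obtain ⟨g, hg⟩ := hy
      obtain ⟨h, hh⟩ := hz
      exact ⟨g * h, fun i => by simp [hg, hh]⟩
    | tmul γ a =>
      obtain ⟨g, hg⟩ := QuotientGroup.mk_surjective γ.toMul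
      -- The tensor `γ ⊗ a` equals `γ ^ a ⊗ 1`, so a power of a lift of `γ` has the same values.
      refine ⟨g ^ a.down, fun i => ?_⟩
      have hγ : γ = Additive.ofMul (Abelianization.of g) := hg.symm
      rw [hγ, ofMul_zpow, map_zsmul]
      simp [mul_comm]
  exact key (groupHomology.H1ToTensorOfIsTrivial (trivialZ Γ) x)

theorem isPrimitiveFamily_iff {Γ : Type u} [Group Γ] {n : ℕ} (v : Fin n → CohomologyOne Γ) :
    IsPrimitiveFamily v ↔
      Function.Surjective fun (g : Γ) (i : Fin n) => ((v i).toHom (Additive.ofMul g)).down := by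
  refine ⟨fun h e => ?_, fun h e => ?_⟩
  · obtain ⟨x, hx⟩ := h e
    obtain ⟨g, hg⟩ := exists_kronecker_eq_toHom v x
    exact ⟨g, funext fun i => (hg i).symm.trans (congrFun hx i)⟩
  · obtain ⟨g, hg⟩ := h e
    refine ⟨groupHomology.H1π (trivialZ Γ)
      ((groupHomology.cycles₁IsoOfIsTrivial (trivialZ Γ)).inv (Finsupp.single g ⟨1⟩)),
      funext fun i => ?_⟩
    refine (kronecker_mk (v i) g ⟨1⟩).trans ?_
    rw [mul_one]
    exact congrFun hg i

/-- A cup product vanishes exactly if the product of the homomorphisms is the deviation of a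
function from being additive. -/
theorem cup_eq_zero_iff {Γ : Type u} [Group Γ] (v w : CohomologyOne Γ) :
    cup v w = 0 ↔ ∃ c : Γ → ℤ, ∀ g h, c (g * h) = c g + c h +
      (v.toHom (Additive.ofMul g)).down * (w.toHom (Additive.ofMul h)).down := by
  rw [cup, groupCohomology.H2π_eq_zero_iff]
  constructor
  · rintro ⟨c, hc⟩
    refine ⟨fun g => (c g).down, fun g h => ?_⟩
    have := congrArg ULift.down (congrFun hc (g, h))
    -- The sign in the cup product matches the coboundary `c h - c (g * h) + c g`.
    change (c h - c (g * h) + c g).down = (-(v.toHom (Additive.ofMul g) *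
      w.toHom (Additive.ofMul h))).down at this
    simp only [ULift.sub_down, ULift.add_down, ULift.neg_down, ULift.mul_down] at this
    linarith
  · rintro ⟨c, hc⟩
    refine ⟨fun g => ⟨c g⟩, funext fun p => ULift.ext _ _ ?_⟩
    change c p.2 - c (p.1 * p.2) + c p.1 = -((v.toHom (Additive.ofMul p.1)).down *
      (w.toHom (Additive.ofMul p.2)).down)
    rw [hc]
    ring

theorem hasPrimitiveCupZero_iff {Γ : Type u} [Group Γ] {n : ℕ} :
    HasPrimitiveCupZero Γ n ↔ ∃ f : Fin n → Additive Γ →+ ℤ,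
      (Function.Surjective fun (g : Γ) (i : Fin n) => f i (Additive.ofMul g)) ∧
      ∀ i j, ∃ c : Γ → ℤ, ∀ g h, c (g * h) = c g + c h +
        f i (Additive.ofMul g) * f j (Additive.ofMul h) := by
  constructor
  · rintro ⟨v, hv, hc⟩
    exact ⟨fun i => (AddEquiv.ulift : ULift.{u} ℤ ≃+ ℤ).toAddMonoidHom.comp (v i).toHom,
      (isPrimitiveFamily_iff v).1 hv, fun i j => (cup_eq_zero_iff _ _).1 (hc i j)⟩
  · rintro ⟨f, hf, hc⟩
    have h : ∀ i, (CohomologyOne.ofHom (AddEquiv.ulift.symm.toAddMonoidHom.comp (f i))).toHom =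
        AddEquiv.ulift.symm.toAddMonoidHom.comp (f i) := fun i => CohomologyOne.toHom_ofHom _
    refine ⟨fun i => CohomologyOne.ofHom (AddEquiv.ulift.symm.toAddMonoidHom.comp (f i)),
      (isPrimitiveFamily_iff _).2 ?_, fun i j => (cup_eq_zero_iff _ _).2 ?_⟩
    · simp only [h]
      exact hf
    · simp only [h]
      exact hc i j

/-! ### Commutators in groups of class two -/

section ClassTwo

variable {G : Type*} [Group G]

theorem commutatorElement_mem_center_of_lowerCentralSeries_eq_bot
    (hG : (⊤ : Subgroup G).lowerCentralSeries 2 = ⊥) (g h : G) : ⁅g, h⁆ ∈ Subgroup.center G := by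
  rw [Subgroup.mem_center_iff]
  intro k
  have : ⁅⁅g, h⁆, k⁆ ∈ (⊤ : Subgroup G).lowerCentralSeries 2 :=
    Subgroup.commutator_mem_commutator
      (Subgroup.commutator_mem_commutator (Subgroup.mem_top g) (Subgroup.mem_top h))
      (Subgroup.mem_top k)
  rw [hG, Subgroup.mem_bot, commutatorElement_eq_one_iff_mul_comm] at this
  exact this.symm

theorem lowerCentralSeries_two_eq_bot (hG : ∀ g h : G, ⁅g, h⁆ ∈ Subgroup.center G) :
    (⊤ : Subgroup G).lowerCentralSeries 2 = ⊥ := by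
  have h1 : (⊤ : Subgroup G).lowerCentralSeries 1 ≤ Subgroup.center G :=
    Subgroup.commutator_le.2 fun g _ h _ => hG g h
  rw [eq_bot_iff]
  refine Subgroup.commutator_le.2 fun g hg h _ => ?_
  rw [Subgroup.mem_bot, commutatorElement_eq_one_iff_mul_comm]
  exact ((Subgroup.mem_center_iff.1 (h1 hg)) h).symm

/-- In a group of class two, `g ↦ [g, h]` is a homomorphism. -/
def commutatorHom (hG : ∀ g h : G, ⁅g, h⁆ ∈ Subgroup.center G) (h : G) : G →* G where
  toFun g := ⁅g, h⁆
  map_one' := commutatorElement_one_left h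
  map_mul' a b := by
    have hb := Subgroup.mem_center_iff.1 (hG b h) a
    calc ⁅a * b, h⁆ = (a * ⁅b, h⁆) * h * a⁻¹ * h⁻¹ := by simp [commutatorElement_def, mul_assoc]
      _ = ⁅b, h⁆ * ⁅a, h⁆ := by rw [hb]; simp [commutatorElement_def, mul_assoc]
      _ = ⁅a, h⁆ * ⁅b, h⁆ := (Subgroup.mem_center_iff.1 (hG b h) _).symm

/-- In a group of class two, the commutators of generators generate the commutator subgroup. -/
theorem commutator_le_of_generators (hG : ∀ g h : G, ⁅g, h⁆ ∈ Subgroup.center G) {S : Set G}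
    (hS : Subgroup.closure S = ⊤) (K : Subgroup G) (hK : ∀ s ∈ S, ∀ t ∈ S, ⁅s, t⁆ ∈ K) :
    commutator G ≤ K := by
  have key : ∀ h : G, (∀ s ∈ S, ⁅s, h⁆ ∈ K) → ∀ g : G, ⁅g, h⁆ ∈ K := by
    intro h hs g
    have : Subgroup.closure S ≤ K.comap (commutatorHom hG h) := (Subgroup.closure_le _).2 hs
    exact this (hS ▸ Subgroup.mem_top g)
  refine Subgroup.commutator_le.2 fun g _ h _ => key h (fun s hs => ?_) g
  -- Linearity in the second variable comes from the first by `[s, h] = [h, s]⁻¹`.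
  rw [← commutatorElement_inv]
  exact K.inv_mem (key s (fun t ht => hK t ht s hs) h)

end ClassTwo

/-! ### Heisenberg groups -/

/-- The group of pairs `(a, b)` of integral vectors with
`(a, b) (a', b') = (a + a', b + b' + (a_{s(p)} a'_{t(p)})_p)`. -/
@[ext]
structure HeisenbergGroup {ι P : Type*} (s t : P → ι) where
  /-- The linear coordinates. -/
  lin : ι → ℤ
  /-- The central coordinates. -/
  quad : P → ℤ

namespace HeisenbergGroup

variable {ι P : Type*} {s t : P → ι}

instance : Mul (HeisenbergGroup s t) :=
  ⟨fun x y => ⟨x.lin + y.lin, fun p => x.quad p + y.quad p + x.lin (s p) * y.lin (t p)⟩⟩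

instance : One (HeisenbergGroup s t) := ⟨⟨0, 0⟩⟩

instance : Inv (HeisenbergGroup s t) :=
  ⟨fun x => ⟨-x.lin, fun p => -x.quad p + x.lin (s p) * x.lin (t p)⟩⟩

@[simp] theorem lin_mul (x y : HeisenbergGroup s t) : (x * y).lin = x.lin + y.lin := rfl

@[simp] theorem quad_mul (x y : HeisenbergGroup s t) (p : P) :
    (x * y).quad p = x.quad p + y.quad p + x.lin (s p) * y.lin (t p) := rfl

@[simp] theorem lin_one : (1 : HeisenbergGroup s t).lin = 0 := rfl

@[simp] theorem quad_one : (1 : HeisenbergGroup s t).quad = 0 := rfl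

@[simp] theorem lin_inv (x : HeisenbergGroup s t) : x⁻¹.lin = -x.lin := rfl

@[simp] theorem quad_inv (x : HeisenbergGroup s t) (p : P) :
    x⁻¹.quad p = -x.quad p + x.lin (s p) * x.lin (t p) := rfl

instance : Group (HeisenbergGroup s t) :=
  Group.ofLeftAxioms
    (fun x y z => by
      ext p
      · simp [add_assoc]
      · simp; ring)
    (fun x => by ext p <;> simp)
    (fun x => by ext p <;> simp)

/-- The projection to the linear coordinates. -/
def linHom (s t : P → ι) : HeisenbergGroup s t →* Multiplicative (ι → ℤ) where
  toFun x := Multiplicative.ofAdd x.lin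
  map_one' := rfl
  map_mul' _ _ := rfl

/-- The inclusion of the central coordinates. -/
def central (s t : P → ι) : Multiplicative (P → ℤ) →* HeisenbergGroup s t where
  toFun b := ⟨0, b.toAdd⟩
  map_one' := rfl
  map_mul' b c := by ext p <;> simp

theorem commutatorElement_eq (x y : HeisenbergGroup s t) :
    ⁅x, y⁆ = central s t (Multiplicative.ofAdd fun p =>
      x.lin (s p) * y.lin (t p) - y.lin (s p) * x.lin (t p)) := by
  rw [commutatorElement_def]
  ext p
  · simp [central]
  · simp [central]; ring

theorem central_mem_center (b : Multiplicative (P → ℤ)) :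
    central s t b ∈ Subgroup.center (HeisenbergGroup s t) := by
  rw [Subgroup.mem_center_iff]
  intro x
  ext p <;> simp [central, add_comm]

theorem commutatorElement_mem_center (x y : HeisenbergGroup s t) :
    ⁅x, y⁆ ∈ Subgroup.center (HeisenbergGroup s t) := by
  rw [commutatorElement_eq]
  exact central_mem_center _

variable (s t) in
/-- The element whose only nonzero coordinate is the linear coordinate `1` at `i`. -/
def gen [DecidableEq ι] (i : ι) : HeisenbergGroup s t := ⟨Pi.single i 1, 0⟩

end HeisenbergGroup

/-! ### The free nilpotent group of class two -/

/-- The pairs `i < j` of elements of `Fin n`. -/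
abbrev IncreasingPair (n : ℕ) : Type := {p : Fin n × Fin n // p.1 < p.2}

/-- The Heisenberg group with one central coordinate for each pair `i < j`. -/
abbrev FreeHeisenberg (n : ℕ) : Type :=
  HeisenbergGroup (fun p : IncreasingPair n => p.1.1) (fun p => p.1.2)

namespace FreeHeisenberg

open HeisenbergGroup

variable {n : ℕ}

/-- The subtracted term of the commutator formula could only contribute at the reversed pair, which
is not increasing. Central coordinates play no role, so any lifts of the two basis vectors will do.
-/
theorem commutatorElement_of_lin_eq_single {x y : FreeHeisenberg n} (p : IncreasingPair n)
    (hx : x.lin = Pi.single p.1.1 1) (hy : y.lin = Pi.single p.1.2 1) :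
    ⁅x, y⁆ = central _ _ (Multiplicative.ofAdd (Pi.single p 1)) := by
  rw [commutatorElement_eq, hx, hy]
  congr 2
  obtain ⟨⟨i, j⟩, hij⟩ := p
  ext ⟨⟨k, l⟩, hkl⟩
  simp only [Pi.single_apply, Subtype.mk.injEq, Prod.mk.injEq] at *
  split_ifs <;> grind

/-- A subgroup which surjects onto the linear coordinates is everything. -/
theorem surjective_of_lin_surjective {G : Type*} [Group G] (f : G →* FreeHeisenberg n)
    (hf : Function.Surjective fun g => (f g).lin) : Function.Surjective f := by
  rw [← MonoidHom.range_eq_top, eq_top_iff]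
  -- The central part is reached through commutators of preimages of basis vectors.
  have hcen : ∀ b : IncreasingPair n → ℤ,
      central _ _ (Multiplicative.ofAdd b) ∈ f.range := by
    intro b
    have hb : Multiplicative.ofAdd b =
        ∏ p, (Multiplicative.ofAdd (Pi.single p 1 : IncreasingPair n → ℤ)) ^ b p := by
      simp_rw [← ofAdd_zsmul]
      rw [← ofAdd_sum]
      congr 1
      ext q
      simp [Finset.sum_apply, Pi.single_apply]
    rw [hb]
    refine (f.range.comap (central _ _)).prod_mem fun p _ => Subgroup.zpow_mem _ ?_ _
    obtain ⟨g, hg⟩ := hf (Pi.single p.1.1 1)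
    obtain ⟨h, hh⟩ := hf (Pi.single p.1.2 1)
    refine ⟨⁅g, h⁆, ?_⟩
    rw [map_commutatorElement]
    exact commutatorElement_of_lin_eq_single p hg hh
  intro x _
  obtain ⟨g, hg⟩ := hf x.lin
  have hx : x = f g * central _ _ (Multiplicative.ofAdd (x.quad - (f g).quad)) := by
    ext p
    · simpa [central] using congrFun hg.symm p
    · simp [central]
  rw [hx]
  exact mul_mem ⟨g, rfl⟩ (hcen _)

end FreeHeisenberg

/-- The homomorphism from the free group to a Heisenberg group which maps generators to
generators. -/
def freeToHeisenberg {ι P : Type*} [DecidableEq ι] (s t : P → ι) :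
    FreeGroup ι →* HeisenbergGroup s t :=
  FreeGroup.lift (HeisenbergGroup.gen s t)

theorem freeToHeisenberg_lin_surjective {ι P : Type*} [Fintype ι] [DecidableEq ι] (s t : P → ι) :
    Function.Surjective fun w => (freeToHeisenberg s t w).lin := by
  have : ((HeisenbergGroup.linHom s t).comp (freeToHeisenberg s t)).range = ⊤ := by
    rw [eq_top_iff]
    intro a _
    have ha : a = ∏ i, (Multiplicative.ofAdd (Pi.single i 1 : ι → ℤ)) ^ (a.toAdd i) := by
      simp_rw [← ofAdd_zsmul]
      rw [← ofAdd_sum, ← ofAdd_toAdd a]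
      congr 1
      ext q
      simp [Finset.sum_apply, Pi.single_apply]
    rw [ha]
    refine Subgroup.prod_mem _ fun i _ => Subgroup.zpow_mem _ ?_ _
    refine ⟨FreeGroup.of i, ?_⟩
    simp [freeToHeisenberg, HeisenbergGroup.linHom, HeisenbergGroup.gen]
  exact MonoidHom.range_eq_top.1 this

/-- A word with vanishing exponent sums is a product of commutators. -/
theorem mem_commutator_of_lin_eq_zero {ι P : Type*} [Fintype ι] [DecidableEq ι] (s t : P → ι)
    (w : FreeGroup ι) (hw : (freeToHeisenberg s t w).lin = 0) : w ∈ commutator (FreeGroup ι) := by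
  -- The linear coordinates are the exponent sums, and `r` recovers the class in the abelianization
  -- from them.
  let r : Multiplicative (ι → ℤ) →* Abelianization (FreeGroup ι) :=
    { toFun := fun a => ∏ i, Abelianization.of (FreeGroup.of i) ^ (a.toAdd i)
      map_one' := by simp
      map_mul' := fun a b => by simp [zpow_add, Finset.prod_mul_distrib] }
  have hr : (r.comp (HeisenbergGroup.linHom s t)).comp (freeToHeisenberg s t) =
      Abelianization.of := by
    refine FreeGroup.ext_hom _ _ fun i => ?_
    change ∏ j, Abelianization.of (FreeGroup.of j) ^
      ((freeToHeisenberg s t (FreeGroup.of i)).lin j) = _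
    simp [freeToHeisenberg, HeisenbergGroup.gen, Pi.single_apply, apply_ite, Finset.prod_ite_eq']
  have h1 : Abelianization.of w = 1 := by
    rw [← hr]
    change r (Multiplicative.ofAdd (freeToHeisenberg s t w).lin) = 1
    rw [hw]
    exact map_one r
  exact (QuotientGroup.eq_one_iff w).1 h1

theorem freeLCS_le_ker_freeToHeisenberg {n : ℕ} {P : Type*} (s t : P → Fin n) :
    freeLCS n 2 ≤ (freeToHeisenberg s t).ker := by
  intro w hw
  have h := Subgroup.mem_map_of_mem (freeToHeisenberg s t) hw
  rw [Subgroup.map_lowerCentralSeries] at h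
  have hle : ∀ H : Subgroup (HeisenbergGroup s t), H.lowerCentralSeries 2 ≤
      (⊤ : Subgroup (HeisenbergGroup s t)).lowerCentralSeries 2 := fun H =>
    Subgroup.commutator_mono (Subgroup.commutator_mono le_top le_top) le_top
  have := hle _ h
  rwa [lowerCentralSeries_two_eq_bot HeisenbergGroup.commutatorElement_mem_center,
    Subgroup.mem_bot] at this

/-- The homomorphism from the free nilpotent group of class two to a Heisenberg group. -/
def freeNilpotentToHeisenberg {n : ℕ} {P : Type*} (s t : P → Fin n) :
    FreeGroup (Fin n) ⧸ freeLCS n 2 →* HeisenbergGroup s t :=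
  QuotientGroup.lift _ (freeToHeisenberg s t) (freeLCS_le_ker_freeToHeisenberg s t)

theorem commutatorElement_mem_center_freeNilpotent {n : ℕ}
    (g h : FreeGroup (Fin n) ⧸ freeLCS n 2) : ⁅g, h⁆ ∈ Subgroup.center _ := by
  refine commutatorElement_mem_center_of_lowerCentralSeries_eq_bot ?_ g h
  -- Writing `⊤` as the image of the free group turns the series of the quotient into the image of
  -- `freeLCS n 2`.
  rw [← (⊤ : Subgroup (FreeGroup (Fin n) ⧸ freeLCS n 2)).map_id,
    ← MonoidHom.range_eq_top.2 (QuotientGroup.mk'_surjective (freeLCS n 2)),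
    MonoidHom.range_eq_map, Subgroup.map_id, ← Subgroup.map_lowerCentralSeries]
  exact (Subgroup.map_eq_bot_iff _).2 (by rw [QuotientGroup.ker_mk'])

/-- A quotient of class two of the free group embeds into the Heisenberg group as soon as it maps
to it. -/
theorem injective_of_comp_eq_freeToHeisenberg {n : ℕ} {Q : Type*} [Group Q]
    (hQ : ∀ g h : Q, ⁅g, h⁆ ∈ Subgroup.center Q) (q : FreeGroup (Fin n) →* Q)
    (hq : Function.Surjective q) (θ : Q →* FreeHeisenberg n)
    (hθ : ∀ w, θ (q w) = freeToHeisenberg _ _ w) : Function.Injective θ := by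
  -- The commutators are taken in the centre, which is commutative, so their products define a
  -- homomorphism `K`; it will be inverse to `θ` on the commutator subgroup.
  let c : IncreasingPair n → Subgroup.center Q := fun p =>
    ⟨⁅q (FreeGroup.of p.1.1), q (FreeGroup.of p.1.2)⁆, hQ _ _⟩
  let K : Multiplicative (IncreasingPair n → ℤ) →* Q := (Subgroup.center Q).subtype.comp
    { toFun := fun b => ∏ p, c p ^ (b.toAdd p)
      map_one' := by simp
      map_mul' := fun a b => by simp [zpow_add, Finset.prod_mul_distrib] }
  have hKsingle : ∀ p, K (Multiplicative.ofAdd (Pi.single p 1)) =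
      ⁅q (FreeGroup.of p.1.1), q (FreeGroup.of p.1.2)⁆ := by
    intro p
    change ((∏ r, c r ^ (Pi.single p 1 : IncreasingPair n → ℤ) r : Subgroup.center Q) : Q) = _
    rw [Finset.prod_eq_single p (fun r _ hr => by simp [hr]) (by simp)]
    simp [c]
  have hcomm : commutator Q ≤ K.range := by
    refine commutator_le_of_generators hQ (S := Set.range fun i => q (FreeGroup.of i)) ?_ _ ?_
    · rw [Set.range_comp' q FreeGroup.of, ← MonoidHom.map_closure, FreeGroup.closure_range_of,
        ← MonoidHom.range_eq_map, MonoidHom.range_eq_top.2 hq]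
    · rintro _ ⟨i, rfl⟩ _ ⟨j, rfl⟩
      rcases lt_trichotomy i j with h | h | h
      · exact ⟨_, hKsingle ⟨(i, j), h⟩⟩
      · subst h
        simp
      · rw [← commutatorElement_inv]
        exact K.range.inv_mem ⟨_, hKsingle ⟨(j, i), h⟩⟩
  have hK : ∀ b, θ (K b) = HeisenbergGroup.central _ _ b := by
    intro b
    have hS : ∀ S : Finset (IncreasingPair n), θ
        ((∏ p ∈ S, c p ^ (b.toAdd p) : Subgroup.center Q) : Q) =
        HeisenbergGroup.central _ _
          (∏ p ∈ S, (Multiplicative.ofAdd (Pi.single p 1)) ^ (b.toAdd p)) := by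
      intro S
      induction S using Finset.induction_on with
      | empty => simp
      | insert p S hp ih =>
        rw [Finset.prod_insert hp, Finset.prod_insert hp, Subgroup.coe_mul, map_mul, map_mul, ih,
          Subgroup.coe_zpow, map_zpow, map_zpow]
        congr 2
        change θ ⁅q (FreeGroup.of p.1.1), q (FreeGroup.of p.1.2)⁆ = _
        rw [map_commutatorElement]
        refine FreeHeisenberg.commutatorElement_of_lin_eq_single p ?_ ?_ <;>
          simp [hθ, freeToHeisenberg, HeisenbergGroup.gen]
    refine (hS Finset.univ).trans (congrArg _ ?_)
    simp_rw [← ofAdd_zsmul]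
    rw [← ofAdd_sum, ← ofAdd_toAdd b]
    congr 1
    ext r
    simp [Finset.sum_apply, Pi.single_apply]
  -- A kernel element has zero exponent sums, hence lies in the range of `K`, where the central
  -- coordinates determine it.
  rw [injective_iff_map_eq_one]
  intro y hy
  obtain ⟨w, rfl⟩ := hq y
  have hw : w ∈ commutator (FreeGroup (Fin n)) :=
    mem_commutator_of_lin_eq_zero _ _ w (congrArg HeisenbergGroup.lin ((hθ w).symm.trans hy))
  have hqw : q w ∈ commutator Q := by
    have := Subgroup.mem_map_of_mem q hw
    rw [commutator_def, Subgroup.map_commutator] at this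
    exact Subgroup.commutator_mono le_top le_top this
  obtain ⟨b, hb⟩ := hcomm hqw
  rw [← hb, hK] at hy
  have hb1 : b = 1 := congrArg HeisenbergGroup.quad hy
  rw [← hb, hb1, map_one]

theorem freeNilpotentToHeisenberg_injective (n : ℕ) : Function.Injective
    (freeNilpotentToHeisenberg (fun p : IncreasingPair n => p.1.1) (fun p => p.1.2)) :=
  injective_of_comp_eq_freeToHeisenberg commutatorElement_mem_center_freeNilpotent
    (QuotientGroup.mk' _) (QuotientGroup.mk'_surjective _) _ fun _ => rfl

/-! ### The comparison -/

theorem hasPrimitiveCupZero_of_mapsOnto {Γ : Type u} [Group Γ] {n : ℕ}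
    (h : MapsOntoFreeNilpotent Γ 2 n) : HasPrimitiveCupZero Γ n := by
  obtain ⟨φ, hφ⟩ := h
  -- All ordered pairs are used, diagonal included, so that each `v_i ∪ v_j` gets its own central
  -- coordinate as a trivialisation.
  let ψ : Γ →* HeisenbergGroup (Prod.fst : Fin n × Fin n → Fin n) Prod.snd :=
    (freeNilpotentToHeisenberg _ _).comp φ
  refine hasPrimitiveCupZero_iff.2 ⟨fun i =>
    { toFun := fun g => (ψ g.toMul).lin i
      map_zero' := by simp
      map_add' := fun g h => by simp }, fun e => ?_, fun i j => ?_⟩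
  · obtain ⟨w, hw⟩ := freeToHeisenberg_lin_surjective Prod.fst Prod.snd e
    obtain ⟨g, hg⟩ := hφ (QuotientGroup.mk w)
    refine ⟨g, ?_⟩
    change (freeNilpotentToHeisenberg _ _ (φ g)).lin = e
    rw [hg]
    exact hw
  · exact ⟨fun g => (ψ g).quad (i, j), fun g h => by simp⟩

theorem mapsOnto_of_hasPrimitiveCupZero {Γ : Type u} [Group Γ] {n : ℕ}
    (h : HasPrimitiveCupZero Γ n) : MapsOntoFreeNilpotent Γ 2 n := by
  obtain ⟨f, hf, hc⟩ := hasPrimitiveCupZero_iff.1 h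
  choose c hc using hc
  -- Only the trivialisations for `i < j` are needed.
  let ψ : Γ →* FreeHeisenberg n := MonoidHom.mk'
    (fun g => ⟨fun i => f i (Additive.ofMul g), fun p => c p.1.1 p.1.2 g⟩) (fun g h => by
      ext p
      · simp
      · simp [hc])
  have hψ : Function.Surjective ψ := FreeHeisenberg.surjective_of_lin_surjective ψ hf
  let θ := freeNilpotentToHeisenberg (fun p : IncreasingPair n => p.1.1) (fun p => p.1.2)
  have hθ : Function.Surjective θ := by
    refine FreeHeisenberg.surjective_of_lin_surjective θ fun e => ?_
    obtain ⟨w, hw⟩ := freeToHeisenberg_lin_surjective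
      (fun p : IncreasingPair n => p.1.1) (fun p => p.1.2) e
    exact ⟨QuotientGroup.mk w, hw⟩
  let E := MulEquiv.ofBijective θ ⟨freeNilpotentToHeisenberg_injective n, hθ⟩
  exact ⟨E.symm.toMonoidHom.comp ψ, E.symm.surjective.comp hψ⟩

end

theorem mainTheorem5 (Γ : Type*) [Group Γ] : dNumber 2 Γ = cTwo Γ := by
  have h : ∀ n, MapsOntoFreeNilpotent Γ 2 n ↔ HasPrimitiveCupZero Γ n := fun _ =>
    ⟨hasPrimitiveCupZero_of_mapsOnto, mapsOnto_of_hasPrimitiveCupZero⟩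
  simp only [dNumber, cTwo, h]
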